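/- Let $H$ be a finite-dimensional complex Hilbert space and let $\mathcal E_0,\mathcal E_1$ be quantum operations on $\mathcal B(H)$, i.e. maps $\rho\mapsto\sum_{i=1}^m E_i\rho E_i^\dagger$ with $\sum_{i=1}^m E_i^\dagger E_i=I$; let $\mathcal I$ be the identity operation. The support of a density operator is the span of its eigenvectors with positive eigenvalue. For density operators $\rho_0,\rho_1$ put $$\tilde F(\rho_0,\rho_1)=\max\{|\langle\psi_0|\psi_1\rangle| : \psi_k\in\operatorname{supp}(\rho_k),\ \|\psi_k\|=1,\ k=0,1\},$$ and for an operation $\mathcal E$ put $$\tilde F_1(\mathcal E,\mathcal I)=\min\{\tilde F(\mathcal E(|\psi_0\rangle\langle\psi_0|),|\psi_1\rangle\langle\psi_1|) : \|\psi_0\|=\|\psi_1\|=1,\ \langle\psi_0|\psi_1\rangle=1\}.$$ In a sequential scheme with $N$ queries to an unknown operation $\mathcal E\in\{\mathcal E_0,\mathcal E_1\}$, no auxiliary system is used: one prepares a density operator $\rho$ on $H$, applies $\mathcal E$ to it $N$ times, applying between the $k$-th and the $(k+1)$-th query a known quantum operation $\mathcal T_k$ on $\mathcal B(H)$ for $1\le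 k\le N-1$, and finally performs a two-outcome measurement $\{M_0,M_1\}$, $M_0,M_1\ge 0$, $M_0+M_1=I$. With $\sigma_k$ denoting the final state when $\mathcal E=\mathcal E_k$, the scheme distinguishes $\mathcal E_0$ and $\mathcal E_1$ perfectly if $\operatorname{tr}(M_1\sigma_0)=\operatorname{tr}(M_0\sigma_1)=0$. The operations are sequentially perfectly distinguishable if such a scheme exists for some finite $N$, and $N_{\min}$ is then the least such $N$. If $\mathcal E_0$ and $\mathcal E_1$ are sequentially perfectly distinguishable, then $\arccos\tilde F_1(\mathcal E_0,\mathcal I)+\arccos\tilde F_1(\mathcal E_1,\mathcal I)>0$ and $$N_{\min}\ \ge\ \left\lceil\frac{\pi}{2\bigl(\arccos\tilde F_1(\mathcal E_0,\mathcal I)+\arccos\tilde F_1(\mathcal E_1,\mathcal I)\bigr)}\right\rceil .$$ -/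

import Mathlib

namespace QuantumDiscrimination

section

variable {H : Type*} [NormedAddCommGroup H] [InnerProductSpace ℂ H] [FiniteDimensional ℂ H]

/-- A density operator (quantum state): a positive operator of trace one. -/
def IsDensityOperator (ρ : H →ₗ[ℂ] H) : Prop :=
  ρ.IsPositive ∧ LinearMap.trace ℂ H ρ = 1

/-- The operator `|ψ⟩⟨ψ|`. -/
noncomputable def pureState (ψ : H) : H →ₗ[ℂ] H :=
  (InnerProductSpace.rankOne ℂ ψ ψ).toLinearMap

/-- The support of a positive operator: the span of its eigenvectors with positive eigenvalue. -/
def support (ρ : H →ₗ[ℂ] H) : Submodule ℂ H :=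
  Submodule.span ℂ {v : H | ∃ p : ℝ, 0 < p ∧ ρ v = (p : ℂ) • v}

variable (H) in
/-- A quantum operation on `B(H)`: a map of the form `ρ ↦ ∑ i, Kᵢ ρ Kᵢ†` for finitely many
operators `Kᵢ` (Kraus operators) with `∑ i, Kᵢ† Kᵢ = 1`. -/
structure QuantumOperation where
  toFun : (H →ₗ[ℂ] H) → (H →ₗ[ℂ] H)
  exists_kraus : ∃ (m : ℕ) (K : Fin m → (H →ₗ[ℂ] H)),
    (∑ i, LinearMap.adjoint (K i) ∘ₗ K i) = LinearMap.id ∧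
    ∀ ρ : H →ₗ[ℂ] H, toFun ρ = ∑ i, K i ∘ₗ ρ ∘ₗ LinearMap.adjoint (K i)

instance : CoeFun (QuantumOperation H) (fun _ => (H →ₗ[ℂ] H) → (H →ₗ[ℂ] H)) where
  coe E := E.toFun

variable (H) in
/-- The identity operation. -/
def identityOperation : QuantumOperation H where
  toFun ρ := ρ
  exists_kraus := by
    refine ⟨1, fun _ => LinearMap.id, ?_, fun ρ => ?_⟩ <;> ext v <;>
      simp [← Module.End.one_eq_id]

/-- The maximal fidelity of two states: the maximum of `|⟨ψ₀|ψ₁⟩|` over unit vectors `ψ₀`, `ψ₁` in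
the respective supports. -/
noncomputable def maximalFidelity (ρ₀ ρ₁ : H →ₗ[ℂ] H) : ℝ :=
  sSup {t : ℝ | ∃ ψ₀ ∈ support ρ₀, ∃ ψ₁ ∈ support ρ₁,
    ‖ψ₀‖ = 1 ∧ ‖ψ₁‖ = 1 ∧ t = ‖inner ℂ ψ₀ ψ₁‖}

/-- The `q`-maximal fidelity of two operations: the minimum of the maximal fidelity of the outputs
over pairs of pure input states with `⟨ψ₀|ψ₁⟩ = q`. -/
noncomputable def qMaximalFidelity (q : ℝ) (E₀ E₁ : QuantumOperation H) : ℝ :=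
  sInf {t : ℝ | ∃ ψ₀ ψ₁ : H, ‖ψ₀‖ = 1 ∧ ‖ψ₁‖ = 1 ∧ inner ℂ ψ₀ ψ₁ = (q : ℂ) ∧
    t = maximalFidelity (E₀ (pureState ψ₀)) (E₁ (pureState ψ₁))}

/-- The state after `N` queries to the operation `E` in the sequential scheme with input state `ρ`
and known intermediate operations `T 0, T 1, …`, where `T k` is applied to the output of query
number `k + 1` and gives the input of query number `k + 2`. No auxiliary system is used. -/
def sequentialOutput (E : QuantumOperation H) (ρ : H →ₗ[ℂ] H) (T : ℕ → QuantumOperation H) :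
    ℕ → (H →ₗ[ℂ] H)
  | 0 => ρ
  | 1 => E ρ
  | n + 2 => E (T n (sequentialOutput E ρ T (n + 1)))

/-- Two states are perfectly distinguishable if some two-outcome measurement `{M₀, M₁}` identifies
them without error. -/
def StatesPerfectlyDistinguishable (σ₀ σ₁ : H →ₗ[ℂ] H) : Prop :=
  ∃ M₀ M₁ : H →ₗ[ℂ] H, M₀.IsPositive ∧ M₁.IsPositive ∧ M₀ + M₁ = LinearMap.id ∧
    LinearMap.trace ℂ H (M₁ ∘ₗ σ₀) = 0 ∧ LinearMap.trace ℂ H (M₀ ∘ₗ σ₁) = 0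

/-- Some sequential scheme with `N` queries distinguishes the two operations perfectly. -/
def SequentiallyDistinguishableIn (E₀ E₁ : QuantumOperation H) (N : ℕ) : Prop :=
  ∃ (ρ : H →ₗ[ℂ] H) (T : ℕ → QuantumOperation H), IsDensityOperator ρ ∧
    StatesPerfectlyDistinguishable (sequentialOutput E₀ ρ T N) (sequentialOutput E₁ ρ T N)

/-- The two operations are sequentially perfectly distinguishable: finitely many queries suffice. -/
def SequentiallyPerfectlyDistinguishable (E₀ E₁ : QuantumOperation H) : Prop :=
  ∃ N : ℕ, SequentiallyDistinguishableIn E₀ E₁ N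

/-- The optimal query number: the least number of queries of a perfectly distinguishing sequential
scheme. -/
noncomputable def optimalSequentialQueryNumber (E₀ E₁ : QuantumOperation H) : ℕ :=
  sInf {N : ℕ | SequentiallyDistinguishableIn E₀ E₁ N}

end

end QuantumDiscrimination

/-!
Measure the distance of two states by the angle `arccos F̃`, the least angle between a ray in the
support of one and a ray in the support of the other. An operation with Kraus operators `Kᵢ` maps
`support σ` onto `⨆ i, Kᵢ (support σ)`. Because `∑ i, ‖Kᵢ x‖ ‖Kᵢ y‖ ≤ ‖x‖ ‖y‖` and
`∑ i, ⟪Kᵢ x, Kᵢ y⟫ = ⟪x, y⟫`, some `Kᵢ` does not increase the angle between the rays of `x` and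
`y`; hence the operations `T k`, which are the same in both runs, never increase the angle.
A query to `E` turns a pure state by at most `arccos F̃₁(E, I)`, so the triangle inequality for rays
lets each query add at most `arccos F̃₁(E₀, I) + arccos F̃₁(E₁, I)`. The angle is `0` before the
first query, and perfect distinguishability means that it has grown to `π / 2`.
-/

namespace QuantumDiscrimination

open InnerProductSpace Real
open scoped ComplexOrder

section Positive

variable {𝕜 E F ι : Type*} [RCLike 𝕜] [NormedAddCommGroup E] [InnerProductSpace 𝕜 E]
  [NormedAddCommGroup F] [InnerProductSpace 𝕜 F]

lemma apply_eq_zero_of_inner_apply_self_eq_zero {M : E →ₗ[𝕜] E} (hM : M.IsPositive) {x : E}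
    (hx : inner 𝕜 x (M x) = 0) : M x = 0 := by
  -- Cauchy–Schwarz for the positive semidefinite form `⟪·, M ·⟫`, at `M x` and `x`.
  let form : PreInnerProductSpace.Core 𝕜 E :=
    { inner := fun y z => inner 𝕜 y (M z)
      conj_inner_symm := fun y z => by rw [inner_conj_symm, hM.isSymmetric]
      re_inner_nonneg := hM.re_inner_nonneg_right
      add_left := fun _ _ _ => inner_add_left _ _ _
      smul_left := fun _ _ _ => inner_smul_left _ _ _ }
  have cauchy_schwarz : ‖inner 𝕜 (M x) (M x)‖ * ‖inner 𝕜 x (M (M x))‖ ≤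
      RCLike.re (inner 𝕜 (M x) (M (M x))) * RCLike.re (inner 𝕜 x (M x)) :=
    InnerProductSpace.Core.inner_mul_inner_self_le (c := form) (M x) x
  rw [← hM.isSymmetric x, hx, map_zero, mul_zero] at cauchy_schwarz
  simpa using le_antisymm cauchy_schwarz (by positivity)

lemma ker_sum_of_isPositive [Fintype ι] {M : ι → E →ₗ[𝕜] E} (hM : ∀ i, (M i).IsPositive) :
    LinearMap.ker (∑ i, M i) = ⨅ i, LinearMap.ker (M i) := by
  ext x
  simp only [Submodule.mem_iInf, LinearMap.mem_ker, LinearMap.sum_apply]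
  refine ⟨fun hx i => ?_, fun hx => Finset.sum_eq_zero fun i _ => hx i⟩
  have hsum : ∑ i, inner 𝕜 x (M i x) = 0 := by rw [← inner_sum, hx, inner_zero_right]
  rw [Finset.sum_eq_zero_iff_of_nonneg fun i _ => (hM i).inner_nonneg_right x] at hsum
  exact apply_eq_zero_of_inner_apply_self_eq_zero (hM i) (hsum i (Finset.mem_univ i))

variable [FiniteDimensional 𝕜 E] [FiniteDimensional 𝕜 F]

lemma ker_conj_adjoint {M : E →ₗ[𝕜] E} (hM : M.IsPositive) (K : E →ₗ[𝕜] F) :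
    LinearMap.ker (K ∘ₗ M ∘ₗ LinearMap.adjoint K) =
      (LinearMap.ker M).comap (LinearMap.adjoint K) := by
  ext x
  simp only [Submodule.mem_comap, LinearMap.mem_ker, LinearMap.comp_apply]
  refine ⟨fun hx => apply_eq_zero_of_inner_apply_self_eq_zero hM ?_, fun hx => by rw [hx, map_zero]⟩
  rw [LinearMap.adjoint_inner_left, hx, inner_zero_right]

lemma orthogonal_map_eq_comap_adjoint (K : E →ₗ[𝕜] F) (S : Submodule 𝕜 E) :
    (S.map K)ᗮ = Sᗮ.comap (LinearMap.adjoint K) := by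
  ext x
  simp [Submodule.mem_orthogonal, LinearMap.adjoint_inner_right]

lemma range_sum_conj_adjoint [Fintype ι] {M : E →ₗ[𝕜] E} (hM : M.IsPositive)
    (K : ι → E →ₗ[𝕜] F) :
    LinearMap.range (∑ i, K i ∘ₗ M ∘ₗ LinearMap.adjoint (K i)) =
      ⨆ i, (LinearMap.range M).map (K i) := by
  have hconj : ∀ i, (K i ∘ₗ M ∘ₗ LinearMap.adjoint (K i)).IsPositive :=
    fun i => hM.conj_adjoint (K i)
  have hsymm := (LinearMap.isPositive_sum Finset.univ fun i _ => hconj i).isSymmetric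
  have horth : (LinearMap.range (∑ i, K i ∘ₗ M ∘ₗ LinearMap.adjoint (K i)))ᗮ =
      (⨆ i, (LinearMap.range M).map (K i))ᗮ := by
    rw [hsymm.orthogonal_range, ker_sum_of_isPositive hconj, ← Submodule.iInf_orthogonal]
    simp only [orthogonal_map_eq_comap_adjoint, hM.isSymmetric.orthogonal_range,
      ker_conj_adjoint hM]
  simpa only [Submodule.orthogonal_orthogonal] using congrArg Submodule.orthogonal horth

lemma comp_eq_zero_of_trace_comp_eq_zero {M S : E →ₗ[𝕜] E} (hM : M.IsPositive)
    (hS : S.IsPositive) (htr : LinearMap.trace 𝕜 E (M ∘ₗ S) = 0) : M ∘ₗ S = 0 := by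
  obtain ⟨m, u, hu⟩ := ContinuousLinearMap.isPositive_iff_eq_sum_rankOne.mp
    (S.isPositive_toContinuousLinearMap_iff.mpr hS)
  have hcomp : M ∘ₗ S = ∑ i, (rankOne 𝕜 (M (u i)) (u i)).toLinearMap := by
    ext x
    have hSx : S x = ∑ i, rankOne 𝕜 (u i) (u i) x := by
      simpa using congrArg (fun T : E →L[𝕜] E => T x) hu
    simp [hSx]
  rw [hcomp, map_sum] at htr
  simp only [trace_rankOne] at htr
  rw [Finset.sum_eq_zero_iff_of_nonneg fun i _ => hM.inner_nonneg_right (u i)] at htr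
  rw [hcomp]
  refine Finset.sum_eq_zero fun i hi => ?_
  simp [apply_eq_zero_of_inner_apply_self_eq_zero hM (htr i hi)]

end Positive

section RayAngle

variable {𝕜 E : Type*} [RCLike 𝕜] [NormedAddCommGroup E] [InnerProductSpace 𝕜 E]

variable (𝕜) in
/-- The angle in `[0, π / 2]` between the rays (one-dimensional subspaces) spanned by `x` and `y`.
It is `π / 2` if `x` or `y` is zero. -/
noncomputable def rayAngle (x y : E) : ℝ :=
  arccos (‖inner 𝕜 x y‖ / (‖x‖ * ‖y‖))

lemma rayAngle_comm (x y : E) : rayAngle 𝕜 x y = rayAngle 𝕜 y x := by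
  rw [rayAngle, rayAngle, norm_inner_symm, mul_comm]

lemma rayAngle_self {x : E} (hx : x ≠ 0) : rayAngle 𝕜 x x = 0 := by
  have hnorm : ‖inner 𝕜 x x‖ = ‖x‖ * ‖x‖ := by
    rw [inner_self_eq_norm_sq_to_K, norm_pow, RCLike.norm_ofReal, abs_norm, sq]
  rw [rayAngle, hnorm, div_self (by simpa using hx), arccos_one]

lemma rayAngle_eq_pi_div_two {x y : E} (h : inner 𝕜 x y = 0) : rayAngle 𝕜 x y = π / 2 := by
  rw [rayAngle, h, norm_zero, zero_div, arccos_zero]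

lemma rayAngle_smul_right (x y : E) {c : 𝕜} (hc : c ≠ 0) :
    rayAngle 𝕜 x (c • y) = rayAngle 𝕜 x y := by
  have hc' : ‖c‖ ≠ 0 := norm_ne_zero_iff.mpr hc
  rw [rayAngle, rayAngle, inner_smul_right, norm_mul, norm_smul, mul_left_comm,
    mul_div_mul_left _ _ hc']

lemma rayAngle_smul_left (x y : E) {c : 𝕜} (hc : c ≠ 0) :
    rayAngle 𝕜 (c • x) y = rayAngle 𝕜 x y := by
  rw [rayAngle_comm, rayAngle_smul_right y x hc, rayAngle_comm]

lemma rayAngle_le_angle (x y : E) :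
    letI := InnerProductSpace.rclikeToReal 𝕜 E
    rayAngle 𝕜 x y ≤ InnerProductGeometry.angle x y := by
  refine arccos_le_arccos ?_
  gcongr
  exact RCLike.re_le_norm _

lemma exists_angle_smul_eq_rayAngle (x y : E) :
    letI := InnerProductSpace.rclikeToReal 𝕜 E
    ∃ c : 𝕜, c ≠ 0 ∧ InnerProductGeometry.angle (c • x) y = rayAngle 𝕜 x y := by
  obtain ⟨c, hc, hcxy⟩ := RCLike.exists_norm_eq_mul_self (inner 𝕜 x y)
  have hre : RCLike.re (inner 𝕜 (star c • x) y) = ‖inner 𝕜 x y‖ := by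
    rw [inner_smul_left, RCLike.star_def, RCLike.conj_conj, ← hcxy, RCLike.ofReal_re]
  refine ⟨star c, by simp [← norm_ne_zero_iff, hc], congrArg arccos ?_⟩
  rw [real_inner_eq_re_inner 𝕜, hre, norm_smul, norm_star, hc, one_mul]

lemma rayAngle_le_add (x y z : E) : rayAngle 𝕜 x z ≤ rayAngle 𝕜 x y + rayAngle 𝕜 y z := by
  let _ := InnerProductSpace.rclikeToReal 𝕜 E
  obtain ⟨a, ha, hax⟩ := exists_angle_smul_eq_rayAngle (𝕜 := 𝕜) x y
  obtain ⟨b, hb, hbz⟩ := exists_angle_smul_eq_rayAngle (𝕜 := 𝕜) z y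
  calc rayAngle 𝕜 x z = rayAngle 𝕜 (a • x) (b • z) := by
        rw [rayAngle_smul_left _ _ ha, rayAngle_smul_right _ _ hb]
    _ ≤ InnerProductGeometry.angle (a • x) (b • z) := rayAngle_le_angle _ _
    _ ≤ InnerProductGeometry.angle (a • x) y + InnerProductGeometry.angle y (b • z) :=
        InnerProductGeometry.angle_le_angle_add_angle _ _ _
    _ = rayAngle 𝕜 x y + rayAngle 𝕜 y z := by
        rw [hax, InnerProductGeometry.angle_comm, hbz, rayAngle_comm z]

end RayAngle

section Kraus

variable {𝕜 E F ι : Type*} [RCLike 𝕜] [NormedAddCommGroup E] [InnerProductSpace 𝕜 E]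
  [FiniteDimensional 𝕜 E] [NormedAddCommGroup F] [InnerProductSpace 𝕜 F] [FiniteDimensional 𝕜 F]
  [Fintype ι] {K : ι → E →ₗ[𝕜] F}

lemma sum_inner_kraus (hK : ∑ i, LinearMap.adjoint (K i) ∘ₗ K i = LinearMap.id) (x y : E) :
    ∑ i, inner 𝕜 (K i x) (K i y) = inner 𝕜 x y := by
  have h := congrArg (inner 𝕜 x) (LinearMap.congr_fun hK y)
  simpa [LinearMap.sum_apply, inner_sum, LinearMap.adjoint_inner_right] using h

lemma sum_norm_sq_kraus (hK : ∑ i, LinearMap.adjoint (K i) ∘ₗ K i = LinearMap.id) (x : E) :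
    ∑ i, ‖K i x‖ ^ 2 = ‖x‖ ^ 2 := by
  have h := sum_inner_kraus hK x x
  simp_rw [inner_self_eq_norm_sq_to_K] at h
  exact_mod_cast h

lemma sum_norm_mul_norm_kraus_le (hK : ∑ i, LinearMap.adjoint (K i) ∘ₗ K i = LinearMap.id)
    (x y : E) : ∑ i, ‖K i x‖ * ‖K i y‖ ≤ ‖x‖ * ‖y‖ := by
  simpa [sum_norm_sq_kraus hK] using
    sum_mul_le_sqrt_mul_sqrt Finset.univ (fun i => ‖K i x‖) (fun i => ‖K i y‖)

lemma exists_rayAngle_kraus_le (hK : ∑ i, LinearMap.adjoint (K i) ∘ₗ K i = LinearMap.id)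
    {x y : E} (hxy : inner 𝕜 x y ≠ 0) :
    ∃ i, rayAngle 𝕜 (K i x) (K i y) ≤ rayAngle 𝕜 x y := by
  classical
  set r := ‖inner 𝕜 x y‖ / (‖x‖ * ‖y‖) with hr
  have hx : ‖x‖ ≠ 0 := by rintro h; simp [norm_eq_zero.mp h] at hxy
  have hy : ‖y‖ ≠ 0 := by rintro h; simp [norm_eq_zero.mp h] at hxy
  set s := Finset.univ.filter fun i => inner 𝕜 (K i x) (K i y) ≠ 0
  have hs : s.Nonempty := by
    rw [← sum_inner_kraus hK] at hxy
    obtain ⟨i, hi, hne⟩ := Finset.exists_ne_zero_of_sum_ne_zero hxy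
    exact ⟨i, Finset.mem_filter.mpr ⟨hi, hne⟩⟩
  have hsum : ∑ i ∈ s, r * (‖K i x‖ * ‖K i y‖) ≤ ∑ i ∈ s, ‖inner 𝕜 (K i x) (K i y)‖ :=
    calc ∑ i ∈ s, r * (‖K i x‖ * ‖K i y‖) ≤ ∑ i, r * (‖K i x‖ * ‖K i y‖) :=
          Finset.sum_le_sum_of_subset_of_nonneg s.subset_univ fun i _ _ => by positivity
      _ ≤ r * (‖x‖ * ‖y‖) := by
          rw [← Finset.mul_sum]
          gcongr
          exact sum_norm_mul_norm_kraus_le hK x y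
      _ = ‖∑ i ∈ s, inner 𝕜 (K i x) (K i y)‖ := by
          rw [Finset.sum_filter_ne_zero, sum_inner_kraus hK, hr,
            div_mul_cancel₀ _ (mul_ne_zero hx hy)]
      _ ≤ ∑ i ∈ s, ‖inner 𝕜 (K i x) (K i y)‖ := norm_sum_le _ _
  obtain ⟨i, hi, hle⟩ := Finset.exists_le_of_sum_le hs hsum
  have hi : inner 𝕜 (K i x) (K i y) ≠ 0 := (Finset.mem_filter.mp hi).2
  have hKx : K i x ≠ 0 := by rintro h; simp [h] at hi
  have hKy : K i y ≠ 0 := by rintro h; simp [h] at hi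
  exact ⟨i, arccos_le_arccos ((le_div_iff₀ (by positivity)).mpr hle)⟩

end Kraus

section Support

variable {H : Type*} [NormedAddCommGroup H] [InnerProductSpace ℂ H]

lemma isPositive_pureState (ψ : H) : (pureState ψ).IsPositive :=
  isPositive_rankOne_self ψ

variable [FiniteDimensional ℂ H]

lemma support_eq_range {ρ : H →ₗ[ℂ] H} (hρ : ρ.IsPositive) : support ρ = LinearMap.range ρ := by
  apply le_antisymm
  · refine Submodule.span_le.mpr ?_
    rintro v ⟨p, hp, hv⟩
    have hp' : (p : ℂ) ≠ 0 := Complex.ofReal_ne_zero.mpr hp.ne'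
    exact ⟨(p : ℂ)⁻¹ • v, by rw [map_smul, hv, inv_smul_smul₀ hp']⟩
  · set b := hρ.isSymmetric.eigenvectorBasis rfl
    rw [LinearMap.range_eq_map, ← b.toBasis.span_eq, Submodule.map_span_le]
    rintro _ ⟨i, rfl⟩
    set p := hρ.isSymmetric.eigenvalues rfl i
    have hb : ρ (b i) = (p : ℂ) • b i := hρ.isSymmetric.apply_eigenvectorBasis rfl i
    rw [b.coe_toBasis, hb]
    rcases (hρ.nonneg_eigenvalues rfl i).eq_or_lt with hp | hp
    · simp [p, ← hp]
    · exact Submodule.smul_mem _ _ (Submodule.subset_span ⟨p, hp, hb⟩)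

lemma support_pureState (ψ : H) : support (pureState ψ) = ℂ ∙ ψ := by
  refine le_antisymm ?_ ((Submodule.span_singleton_le_iff_mem _ _).mpr ?_)
  · rw [support_eq_range (isPositive_pureState ψ)]
    rintro _ ⟨v, rfl⟩
    exact Submodule.mem_span_singleton.mpr ⟨inner ℂ ψ v, rfl⟩
  · rcases eq_or_ne ψ 0 with rfl | hψ
    · exact Submodule.zero_mem _
    · exact Submodule.subset_span ⟨‖ψ‖ ^ 2, by positivity, by simp [pureState]⟩

lemma mem_support_pureState (ψ : H) : ψ ∈ support (pureState ψ) :=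
  support_pureState ψ ▸ Submodule.mem_span_singleton_self ψ

lemma IsDensityOperator.support_ne_bot {ρ : H →ₗ[ℂ] H} (hρ : IsDensityOperator ρ) :
    support ρ ≠ ⊥ := by
  rw [support_eq_range hρ.1, Ne, LinearMap.range_eq_bot]
  rintro rfl
  simpa using hρ.2

lemma StatesPerfectlyDistinguishable.support_isOrtho {σ₀ σ₁ : H →ₗ[ℂ] H}
    (h : StatesPerfectlyDistinguishable σ₀ σ₁) (h₀ : σ₀.IsPositive) (h₁ : σ₁.IsPositive) :
    support σ₀ ⟂ support σ₁ := by
  obtain ⟨M₀, M₁, hM₀, hM₁, hsum, ht₀, ht₁⟩ := h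
  rw [support_eq_range h₀, support_eq_range h₁, Submodule.isOrtho_iff_inner_eq]
  rintro _ ⟨u, rfl⟩ _ ⟨v, rfl⟩
  have hu : M₁ (σ₀ u) = 0 := LinearMap.congr_fun (comp_eq_zero_of_trace_comp_eq_zero hM₁ h₀ ht₀) u
  have hv : M₀ (σ₁ v) = 0 := LinearMap.congr_fun (comp_eq_zero_of_trace_comp_eq_zero hM₀ h₁ ht₁) v
  calc inner ℂ (σ₀ u) (σ₁ v) = inner ℂ (σ₀ u) ((M₀ + M₁) (σ₁ v)) := by rw [hsum, LinearMap.id_apply]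
    _ = inner ℂ (M₁ (σ₀ u)) (σ₁ v) := by
        rw [LinearMap.add_apply, hv, zero_add, hM₁.isSymmetric]
    _ = 0 := by rw [hu, inner_zero_left]

namespace QuantumOperation

lemma isPositive_apply (E : QuantumOperation H) {σ : H →ₗ[ℂ] H} (hσ : σ.IsPositive) :
    (E σ).IsPositive := by
  obtain ⟨m, K, -, hE⟩ := E.exists_kraus
  rw [hE]
  exact LinearMap.isPositive_sum _ fun i _ => hσ.conj_adjoint (K i)

lemma exists_kraus_support_apply (E : QuantumOperation H) :
    ∃ (m : ℕ) (K : Fin m → H →ₗ[ℂ] H), ∑ i, LinearMap.adjoint (K i) ∘ₗ K i = LinearMap.id ∧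
      ∀ σ : H →ₗ[ℂ] H, σ.IsPositive → support (E σ) = ⨆ i, (support σ).map (K i) := by
  obtain ⟨m, K, hK, hE⟩ := E.exists_kraus
  refine ⟨m, K, hK, fun σ hσ => ?_⟩
  rw [support_eq_range (E.isPositive_apply hσ), support_eq_range hσ, hE,
    range_sum_conj_adjoint hσ]

lemma support_apply_mono (E : QuantumOperation H) {σ τ : H →ₗ[ℂ] H} (hσ : σ.IsPositive)
    (hτ : τ.IsPositive) (h : support σ ≤ support τ) : support (E σ) ≤ support (E τ) := by
  obtain ⟨m, K, -, hsupp⟩ := E.exists_kraus_support_apply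
  rw [hsupp σ hσ, hsupp τ hτ]
  exact iSup_mono fun i => Submodule.map_mono h

end QuantumOperation

end Support

section SupportAngle

variable {H : Type*} [NormedAddCommGroup H] [InnerProductSpace ℂ H]

/-- The angle `arccos F̃(σ₀, σ₁)` between two states: the least angle between a ray in the support
of `σ₀` and a ray in the support of `σ₁`. -/
noncomputable def supportAngle (σ₀ σ₁ : H →ₗ[ℂ] H) : ℝ :=
  arccos (maximalFidelity σ₀ σ₁)

lemma maximalFidelity_nonneg (σ₀ σ₁ : H →ₗ[ℂ] H) : 0 ≤ maximalFidelity σ₀ σ₁ := by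
  refine Real.sSup_nonneg ?_
  rintro t ⟨φ₀, -, φ₁, -, -, -, rfl⟩
  exact norm_nonneg _

lemma norm_inner_le_maximalFidelity {σ₀ σ₁ : H →ₗ[ℂ] H} {φ₀ φ₁ : H} (h₀ : φ₀ ∈ support σ₀)
    (h₁ : φ₁ ∈ support σ₁) (n₀ : ‖φ₀‖ = 1) (n₁ : ‖φ₁‖ = 1) :
    ‖inner ℂ φ₀ φ₁‖ ≤ maximalFidelity σ₀ σ₁ := by
  refine le_csSup ⟨1, ?_⟩ ⟨φ₀, h₀, φ₁, h₁, n₀, n₁, rfl⟩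
  rintro t ⟨ψ₀, -, ψ₁, -, m₀, m₁, rfl⟩
  simpa [m₀, m₁] using norm_inner_le_norm (𝕜 := ℂ) ψ₀ ψ₁

lemma supportAngle_nonneg (σ₀ σ₁ : H →ₗ[ℂ] H) : 0 ≤ supportAngle σ₀ σ₁ :=
  arccos_nonneg _

lemma supportAngle_le_pi_div_two (σ₀ σ₁ : H →ₗ[ℂ] H) : supportAngle σ₀ σ₁ ≤ π / 2 :=
  arccos_le_pi_div_two.mpr (maximalFidelity_nonneg σ₀ σ₁)

lemma supportAngle_le_rayAngle {σ₀ σ₁ : H →ₗ[ℂ] H} {φ₀ φ₁ : H} (h₀ : φ₀ ∈ support σ₀)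
    (h₁ : φ₁ ∈ support σ₁) : supportAngle σ₀ σ₁ ≤ rayAngle ℂ φ₀ φ₁ := by
  by_cases h : inner ℂ φ₀ φ₁ = 0
  · exact (supportAngle_le_pi_div_two σ₀ σ₁).trans_eq (rayAngle_eq_pi_div_two h).symm
  have hφ₀ : φ₀ ≠ 0 := by rintro rfl; simp at h
  have hφ₁ : φ₁ ≠ 0 := by rintro rfl; simp at h
  refine arccos_le_arccos ?_
  have hunit := norm_inner_le_maximalFidelity
    ((support σ₀).smul_mem ((‖φ₀‖ : ℂ)⁻¹) h₀) ((support σ₁).smul_mem ((‖φ₁‖ : ℂ)⁻¹) h₁)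
    (norm_smul_inv_norm hφ₀) (norm_smul_inv_norm hφ₁)
  simp only [inner_smul_left, inner_smul_right, norm_mul, RCLike.norm_conj, norm_inv,
    Complex.norm_real, norm_norm] at hunit
  convert hunit using 1
  field_simp

lemma le_supportAngle {σ₀ σ₁ : H →ₗ[ℂ] H} {θ : ℝ} (hθ : θ ≤ π / 2)
    (h : ∀ φ₀ ∈ support σ₀, ∀ φ₁ ∈ support σ₁, ‖φ₀‖ = 1 → ‖φ₁‖ = 1 → θ ≤ rayAngle ℂ φ₀ φ₁) :
    θ ≤ supportAngle σ₀ σ₁ := by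
  rcases le_total θ 0 with hneg | hpos
  · exact hneg.trans (supportAngle_nonneg σ₀ σ₁)
  have hcos : maximalFidelity σ₀ σ₁ ≤ cos θ := by
    refine Real.sSup_le ?_ (cos_nonneg_of_neg_pi_div_two_le_of_le (by linarith [pi_pos]) hθ)
    rintro t ⟨φ₀, h₀, φ₁, h₁, n₀, n₁, rfl⟩
    have hray := h φ₀ h₀ φ₁ h₁ n₀ n₁
    rw [rayAngle, n₀, n₁, mul_one, div_one] at hray
    have hone : ‖inner ℂ φ₀ φ₁‖ ≤ 1 := by
      simpa [n₀, n₁] using norm_inner_le_norm (𝕜 := ℂ) φ₀ φ₁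
    calc ‖inner ℂ φ₀ φ₁‖ = cos (arccos ‖inner ℂ φ₀ φ₁‖) :=
          (cos_arccos (by linarith [norm_nonneg (inner ℂ φ₀ φ₁)]) hone).symm
      _ ≤ cos θ := cos_le_cos_of_nonneg_of_le_pi hpos (arccos_le_pi _) hray
  calc θ = arccos (cos θ) := (arccos_cos hpos (by linarith [pi_pos])).symm
    _ ≤ supportAngle σ₀ σ₁ := arccos_le_arccos hcos

lemma supportAngle_comm (σ₀ σ₁ : H →ₗ[ℂ] H) : supportAngle σ₀ σ₁ = supportAngle σ₁ σ₀ := by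
  have hle : ∀ τ₀ τ₁ : H →ₗ[ℂ] H, supportAngle τ₀ τ₁ ≤ supportAngle τ₁ τ₀ := fun τ₀ τ₁ =>
    le_supportAngle (supportAngle_le_pi_div_two _ _) fun φ₁ h₁ φ₀ h₀ _ _ =>
      (supportAngle_le_rayAngle h₀ h₁).trans_eq (rayAngle_comm _ _)
  exact le_antisymm (hle _ _) (hle _ _)

lemma supportAngle_self {ρ : H →ₗ[ℂ] H} (hρ : support ρ ≠ ⊥) : supportAngle ρ ρ = 0 := by
  obtain ⟨φ, hφ, hne⟩ := (Submodule.ne_bot_iff _).mp hρ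
  exact le_antisymm ((supportAngle_le_rayAngle hφ hφ).trans_eq (rayAngle_self hne))
    (supportAngle_nonneg ρ ρ)

lemma supportAngle_anti {σ₀ σ₁ τ₀ τ₁ : H →ₗ[ℂ] H} (h₀ : support σ₀ ≤ support τ₀)
    (h₁ : support σ₁ ≤ support τ₁) : supportAngle τ₀ τ₁ ≤ supportAngle σ₀ σ₁ :=
  le_supportAngle (supportAngle_le_pi_div_two _ _) fun _ hφ₀ _ hφ₁ _ _ =>
    supportAngle_le_rayAngle (h₀ hφ₀) (h₁ hφ₁)

lemma supportAngle_eq_pi_div_two_of_isOrtho {σ₀ σ₁ : H →ₗ[ℂ] H}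
    (h : support σ₀ ⟂ support σ₁) : supportAngle σ₀ σ₁ = π / 2 :=
  le_antisymm (supportAngle_le_pi_div_two _ _) <| le_supportAngle le_rfl fun _ hφ₀ _ hφ₁ _ _ =>
    (rayAngle_eq_pi_div_two (h.inner_eq hφ₀ hφ₁)).ge

variable [FiniteDimensional ℂ H]

lemma le_supportAngle_pureState {σ : H →ₗ[ℂ] H} {ψ : H} {θ : ℝ} (hθ : θ ≤ π / 2)
    (h : ∀ φ ∈ support σ, θ ≤ rayAngle ℂ φ ψ) : θ ≤ supportAngle σ (pureState ψ) := by
  refine le_supportAngle hθ fun φ hφ ψ' hψ' _ hunit => ?_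
  rw [support_pureState] at hψ'
  obtain ⟨c, rfl⟩ := Submodule.mem_span_singleton.mp hψ'
  have hc : c ≠ 0 := by
    rintro rfl
    simp at hunit
  rw [rayAngle_smul_right φ ψ hc]
  exact h φ hφ

-- False with an arbitrary state in the middle, whose support can meet both others.
lemma supportAngle_le_add_pureState (σ₀ σ₁ : H →ₗ[ℂ] H) (ψ : H) :
    supportAngle σ₀ σ₁ ≤ supportAngle σ₀ (pureState ψ) + supportAngle (pureState ψ) σ₁ := by
  have hθ := supportAngle_le_pi_div_two σ₀ σ₁
  rw [supportAngle_comm (pureState ψ), ← sub_le_iff_le_add]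
  refine le_supportAngle_pureState
    (by linarith [supportAngle_nonneg σ₁ (pureState ψ)]) fun φ₀ h₀ => ?_
  rw [sub_le_comm]
  refine le_supportAngle_pureState
    (by linarith [show 0 ≤ rayAngle ℂ φ₀ ψ from arccos_nonneg _]) fun φ₁ h₁ => ?_
  rw [sub_le_iff_le_add']
  calc supportAngle σ₀ σ₁ ≤ rayAngle ℂ φ₀ φ₁ := supportAngle_le_rayAngle h₀ h₁
    _ ≤ rayAngle ℂ φ₀ ψ + rayAngle ℂ φ₁ ψ := by
        rw [rayAngle_comm φ₁]
        exact rayAngle_le_add φ₀ ψ φ₁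

end SupportAngle

section Queries

variable {H : Type*} [NormedAddCommGroup H] [InnerProductSpace ℂ H] [FiniteDimensional ℂ H]

lemma supportAngle_apply_le (T : QuantumOperation H) {σ₀ σ₁ : H →ₗ[ℂ] H} (h₀ : σ₀.IsPositive)
    (h₁ : σ₁.IsPositive) : supportAngle (T σ₀) (T σ₁) ≤ supportAngle σ₀ σ₁ := by
  refine le_supportAngle (supportAngle_le_pi_div_two _ _) fun φ₀ hφ₀ φ₁ hφ₁ _ _ => ?_
  by_cases hφ : inner ℂ φ₀ φ₁ = 0
  · exact (supportAngle_le_pi_div_two _ _).trans_eq (rayAngle_eq_pi_div_two hφ).symm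
  obtain ⟨m, K, hK, hsupp⟩ := T.exists_kraus_support_apply
  obtain ⟨i, hi⟩ := exists_rayAngle_kraus_le hK hφ
  have hmem : ∀ {σ : H →ₗ[ℂ] H} {φ : H}, σ.IsPositive → φ ∈ support σ → K i φ ∈ support (T σ) :=
    fun hσ hφ => hsupp _ hσ ▸ Submodule.mem_iSup_of_mem i (Submodule.mem_map_of_mem hφ)
  exact (supportAngle_le_rayAngle (hmem h₀ hφ₀) (hmem h₁ hφ₁)).trans hi

/-- The angle `arccos F̃₁(E, I)`: the largest angle between a pure state and its image under `E`. -/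
noncomputable def queryAngle (E : QuantumOperation H) : ℝ :=
  arccos (qMaximalFidelity 1 E (identityOperation H))

lemma queryAngle_nonneg (E : QuantumOperation H) : 0 ≤ queryAngle E :=
  arccos_nonneg _

lemma supportAngle_apply_pureState_le_queryAngle (E : QuantumOperation H) {ψ : H}
    (hψ : ‖ψ‖ = 1) : supportAngle (E (pureState ψ)) (pureState ψ) ≤ queryAngle E := by
  refine arccos_le_arccos (csInf_le ⟨0, ?_⟩ ⟨ψ, ψ, hψ, hψ, ?_, rfl⟩)
  · rintro t ⟨ψ₀, ψ₁, -, -, -, rfl⟩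
    exact maximalFidelity_nonneg _ _
  · simp [inner_self_eq_norm_sq_to_K, hψ]

lemma supportAngle_apply_apply_le (E₀ E₁ : QuantumOperation H) {σ₀ σ₁ : H →ₗ[ℂ] H}
    (h₀ : σ₀.IsPositive) (h₁ : σ₁.IsPositive) :
    supportAngle (E₀ σ₀) (E₁ σ₁) ≤ supportAngle σ₀ σ₁ + (queryAngle E₀ + queryAngle E₁) := by
  rw [← sub_le_iff_le_add]
  refine le_supportAngle ?_ fun ψ₀ hψ₀ ψ₁ hψ₁ n₀ n₁ => ?_
  · linarith [supportAngle_le_pi_div_two (E₀ σ₀) (E₁ σ₁), queryAngle_nonneg E₀,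
      queryAngle_nonneg E₁]
  have hsupp : ∀ (E : QuantumOperation H) {σ : H →ₗ[ℂ] H} {ψ : H}, σ.IsPositive → ψ ∈ support σ →
      support (E (pureState ψ)) ≤ support (E σ) := fun E σ ψ hσ hψ =>
    E.support_apply_mono (isPositive_pureState ψ) hσ <| by
      rwa [support_pureState, Submodule.span_singleton_le_iff_mem]
  have hquery₀ := supportAngle_apply_pureState_le_queryAngle E₀ n₀
  have hquery₁ := supportAngle_apply_pureState_le_queryAngle E₁ n₁
  have hpure : supportAngle (pureState ψ₀) (pureState ψ₁) ≤ rayAngle ℂ ψ₀ ψ₁ :=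
    supportAngle_le_rayAngle (mem_support_pureState ψ₀) (mem_support_pureState ψ₁)
  rw [sub_le_iff_le_add]
  calc supportAngle (E₀ σ₀) (E₁ σ₁)
      ≤ supportAngle (E₀ (pureState ψ₀)) (E₁ (pureState ψ₁)) :=
        supportAngle_anti (hsupp E₀ h₀ hψ₀) (hsupp E₁ h₁ hψ₁)
    _ ≤ supportAngle (E₀ (pureState ψ₀)) (pureState ψ₀) +
          supportAngle (pureState ψ₀) (E₁ (pureState ψ₁)) :=
        supportAngle_le_add_pureState _ _ ψ₀
    _ ≤ supportAngle (E₀ (pureState ψ₀)) (pureState ψ₀) +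
          (supportAngle (pureState ψ₀) (pureState ψ₁) +
            supportAngle (E₁ (pureState ψ₁)) (pureState ψ₁)) := by
        gcongr
        rw [supportAngle_comm (E₁ _)]
        exact supportAngle_le_add_pureState _ _ ψ₁
    _ ≤ rayAngle ℂ ψ₀ ψ₁ + (queryAngle E₀ + queryAngle E₁) := by linarith

lemma isPositive_sequentialOutput (E : QuantumOperation H) {ρ : H →ₗ[ℂ] H} (hρ : ρ.IsPositive)
    (T : ℕ → QuantumOperation H) : ∀ N, (sequentialOutput E ρ T N).IsPositive
  | 0 => hρ
  | 1 => E.isPositive_apply hρ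
  | n + 2 => E.isPositive_apply
      ((T n).isPositive_apply (isPositive_sequentialOutput E hρ T (n + 1)))

lemma supportAngle_sequentialOutput_le (E₀ E₁ : QuantumOperation H) {ρ : H →ₗ[ℂ] H}
    (hρ : ρ.IsPositive) (hsupp : support ρ ≠ ⊥) (T : ℕ → QuantumOperation H) : ∀ N : ℕ,
    supportAngle (sequentialOutput E₀ ρ T N) (sequentialOutput E₁ ρ T N) ≤
      N * (queryAngle E₀ + queryAngle E₁)
  | 0 => by simp [sequentialOutput, supportAngle_self hsupp]
  | 1 => by
    simpa [sequentialOutput, supportAngle_self hsupp] using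
      supportAngle_apply_apply_le E₀ E₁ hρ hρ
  | n + 2 => by
    have ih := supportAngle_sequentialOutput_le E₀ E₁ hρ hsupp T (n + 1)
    have pos₀ := isPositive_sequentialOutput E₀ hρ T (n + 1)
    have pos₁ := isPositive_sequentialOutput E₁ hρ T (n + 1)
    have hT := supportAngle_apply_le (T n) pos₀ pos₁
    have hE := supportAngle_apply_apply_le E₀ E₁ ((T n).isPositive_apply pos₀)
      ((T n).isPositive_apply pos₁)
    push_cast at ih ⊢
    simp only [sequentialOutput]
    linarith

lemma SequentiallyDistinguishableIn.pi_div_two_le {E₀ E₁ : QuantumOperation H} {N : ℕ}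
    (h : SequentiallyDistinguishableIn E₀ E₁ N) :
    π / 2 ≤ N * (queryAngle E₀ + queryAngle E₁) := by
  obtain ⟨ρ, T, hρ, hdist⟩ := h
  have hortho := hdist.support_isOrtho (isPositive_sequentialOutput E₀ hρ.1 T N)
    (isPositive_sequentialOutput E₁ hρ.1 T N)
  rw [← supportAngle_eq_pi_div_two_of_isOrtho hortho]
  exact supportAngle_sequentialOutput_le E₀ E₁ hρ.1 hρ.support_ne_bot T N

end Queries

end QuantumDiscrimination

theorem mainTheorem6 {H : Type*} [NormedAddCommGroup H] [InnerProductSpace ℂ H]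
    [FiniteDimensional ℂ H] (E₀ E₁ : QuantumDiscrimination.QuantumOperation H)
    (hdist : QuantumDiscrimination.SequentiallyPerfectlyDistinguishable E₀ E₁) :
    0 < Real.arccos (QuantumDiscrimination.qMaximalFidelity 1 E₀
          (QuantumDiscrimination.identityOperation H)) +
        Real.arccos (QuantumDiscrimination.qMaximalFidelity 1 E₁
          (QuantumDiscrimination.identityOperation H)) ∧
    ⌈Real.pi /
        (2 * (Real.arccos (QuantumDiscrimination.qMaximalFidelity 1 E₀
                (QuantumDiscrimination.identityOperation H)) +
              Real.arccos (QuantumDiscrimination.qMaximalFidelity 1 E₁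
                (QuantumDiscrimination.identityOperation H))))⌉ ≤
      (QuantumDiscrimination.optimalSequentialQueryNumber E₀ E₁ : ℤ) := by
  have hmin : QuantumDiscrimination.SequentiallyDistinguishableIn E₀ E₁
      (QuantumDiscrimination.optimalSequentialQueryNumber E₀ E₁) := Nat.sInf_mem hdist
  have hangle := hmin.pi_div_two_le
  have hpos : 0 < QuantumDiscrimination.queryAngle E₀ + QuantumDiscrimination.queryAngle E₁ :=
    pos_of_mul_pos_right (Real.pi_div_two_pos.trans_le hangle) (Nat.cast_nonneg _)
  refine ⟨hpos, Int.ceil_le.mpr ?_⟩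
  change Real.pi / (2 * (QuantumDiscrimination.queryAngle E₀ +
    QuantumDiscrimination.queryAngle E₁)) ≤ _
  rw [div_le_iff₀ (by positivity), Int.cast_natCast]
  linarith
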